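/- Let $\mathcal X,\mathcal Y$ be measurable spaces and let $P$ (source) and $Q$ (target) be probability measures on $\mathcal X\times\mathcal Y$ satisfying the covariate shift condition: they have a common conditional distribution of $y$ given $x$, i.e. there is a Markov kernel $\kappa$ from $\mathcal X$ to $\mathcal Y$ with $P=P_X\otimes\kappa$ and $Q=Q_X\otimes\kappa$, where $P_X,Q_X$ are the marginals on $\mathcal X$. Let $p(x),q(x)$ be densities of $P_X,Q_X$ with respect to a $\sigma$-finite measure on $\mathcal X$, let $w^*(x)=q(x)/p(x)$ be the importance weight (with $0/0=0$ and $c/0=\infty$ for $c>0$), and let $b<\infty$ satisfy $w^*(x)\le b$ for all $x\in\mathcal X$. Let $f:\mathcal X\times\mathcal Y\to\mathbb R_{\ge0}$ be measurable, and for $\tau\ge0$ put $C_\tau(x)=\{y\in\mathcal Y: f(x,y)\ge\tau\}$ and $L_Q(C_\tau)=\Pr_{(x,y)\sim Q}[y\notin C_\tau(x)]$. Let $m\in\mathbb N$ and $\varepsilon,\delta\in(0,1)$. For integers $0\le k\le n$ let $F(k;n,\theta)=\sum_{i=0}^k\binom ni\theta^i(1-\theta)^{n-i}$, and let the Clopper–Pearson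 upper bound be $$\overline\theta(k;n,\delta)=\inf\big(\{\theta\in[0,1]: F(k;n,\theta)\le\delta\}\cup\{1\}\big).$$ For a finite sample $T$ (a multiset of labeled examples) let $U_{\mathrm{CP}}(C,T,\delta)=\overline\theta(\bar L_T(C);|T|,\delta)$, where $\bar L_T(C)$ is the number of $(x,y)\in T$ with $y\notin C(x)$. For a calibration set $S_m=((x_i,y_i))_{i=1}^m$, $V=(V_1,\dots,V_m)\in\mathbb R^m$ and $\vec w^*=(w^*(x_1),\dots,w^*(x_m))$, let $T_N(S_m,V,\vec w^*,b)$ be the sample of those $(x_i,y_i)$ with $V_i\le w^*(x_i)/b$, and let the rejection sampling Clopper–Pearson bound be $U_{\mathrm{RSCP}}(C,S_m,V,\vec w^*,b,\delta)=U_{\mathrm{CP}}(C,T_N(S_m,V,\vec w^*,b),\delta)$. Put $$\hat\tau=\hat\tau(S_m,V)=\max\{\tau\ge0: U_{\mathrm{RSCP}}(C_\tau,S_m,V,\vec w^*,b,\delta)\le\varepsilon\},$$ with $\hat\tau=0$ if no $\tau\ge0$ satisfies the constraint. Then the maximum exists whenever the constraint is feasible, and, for $S_m\sim P^m$ and, independently,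 $V\sim\mathrm{Uniform}([0,1])^m$, $$\Pr_{S_m,V}\big[L_Q(C_\tau)\le\varepsilon\ \text{ for all } 0\le\tau\le\hat\tau(S_m,V)\big]\ \ge\ 1-\delta .$$ In particular, $\Pr_{S_m,V}[L_Q(C_\tau)\le\varepsilon]\ge1-\delta$ for every (possibly data-dependent) choice of $\tau\in[0,\hat\tau(S_m,V)]$. -/

import Mathlib

open MeasureTheory ProbabilityTheory
open scoped NNReal ENNReal

noncomputable section

namespace RSCP

/-- The threshold prediction set `C_τ(x) = {y | f(x, y) ≥ τ}`. -/
def predSet {X Y : Type*} (f : X × Y → ℝ≥0) (τ : ℝ≥0) (x : X) : Set Y :=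
  {y | τ ≤ f (x, y)}

/-- The expected error `L_Q(C) = Pr_{(x,y) ∼ Q}[y ∉ C(x)]`. -/
def expErr {X Y : Type*} [MeasurableSpace X] [MeasurableSpace Y]
    (Q : Measure (X × Y)) (C : X → Set Y) : ℝ :=
  Q.real {z | z.2 ∉ C z.1}

open Classical in
/-- The empirical error count of `C` on a finite sample `T` (a multiset of labeled examples). -/
def errCount {X Y : Type*} (C : X → Set Y) (T : Multiset (X × Y)) : ℕ :=
  T.countP (fun z => z.2 ∉ C z.1)

/-- The CDF `F(k; n, θ)` of the binomial distribution with `n` trials and success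
probability `θ`. -/
def binomCDF (k n : ℕ) (θ : ℝ) : ℝ :=
  ∑ i ∈ Finset.range (k + 1), (n.choose i : ℝ) * θ ^ i * (1 - θ) ^ (n - i)

/-- The Clopper–Pearson upper bound. -/
def cpUpper (k n : ℕ) (δ : ℝ) : ℝ :=
  sInf ({θ : ℝ | θ ∈ Set.Icc (0 : ℝ) 1 ∧ binomCDF k n θ ≤ δ} ∪ {1})

/-- `U_CP(C, T, δ)`: the Clopper–Pearson bound of the error count of `C` on the sample `T`. -/
def UCP {X Y : Type*} (C : X → Set Y) (T : Multiset (X × Y)) (δ : ℝ) : ℝ :=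
  cpUpper (errCount C T) T.card δ

open Classical in
/-- Rejection sampling: keep the examples `S i` with `V i ≤ w i / b` (with multiplicity). -/
def accepted {X Y : Type*} {m : ℕ} (S : Fin m → X × Y) (V w : Fin m → ℝ) (b : ℝ) :
    Multiset (X × Y) :=
  (Finset.univ.filter (fun i => V i ≤ w i / b)).val.map S

/-- The rejection sampling Clopper–Pearson bound. -/
def URSCP {X Y : Type*} {m : ℕ} (C : X → Set Y) (S : Fin m → X × Y) (V w : Fin m → ℝ)
    (b δ : ℝ) : ℝ :=
  UCP C (accepted S V w b) δ

/-- The thresholds `τ ≥ 0` with `U_RSCP(C_τ, S, V, w, b, δ) ≤ ε`. -/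
def feasible {X Y : Type*} {m : ℕ} (f : X × Y → ℝ≥0) (S : Fin m → X × Y) (V w : Fin m → ℝ)
    (b δ ε : ℝ) : Set ℝ≥0 :=
  {τ | URSCP (predSet f τ) S V w b δ ≤ ε}

/-- The chosen threshold `τ̂`. The supremum of the empty set in `ℝ≥0` is `0`, which is the
convention for `τ̂` when the problem is infeasible. -/
def tauHat {X Y : Type*} {m : ℕ} (f : X × Y → ℝ≥0) (S : Fin m → X × Y) (V w : Fin m → ℝ)
    (b δ ε : ℝ) : ℝ≥0 :=
  sSup (feasible f S V w b δ ε)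

/-- The importance weight `w*(x) = q(x) / p(x)`, where `q(x) / 0 = ∞` if `q(x) ≠ 0`, so that a
finite bound on `w*` forces `q(x) = 0` wherever `p(x) = 0`. -/
def impWeight {X : Type*} (pX qX : X → ℝ≥0∞) (x : X) : ℝ≥0∞ :=
  qX x / pX x

/-- The vector of importance weights of the examples of `S`. -/
def weights {X Y : Type*} {m : ℕ} (pX qX : X → ℝ≥0∞) (S : Fin m → X × Y) : Fin m → ℝ :=
  fun i => (impWeight pX qX (S i).1).toReal

/-- Covariate shift: `P` and `Q` have a common conditional distribution of the label given the
covariate. -/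
def CovariateShift {X Y : Type*} [MeasurableSpace X] [MeasurableSpace Y]
    (P Q : Measure (X × Y)) : Prop :=
  ∃ κ : Kernel X Y, IsMarkovKernel κ ∧ P = P.fst ⊗ₘ κ ∧ Q = Q.fst ⊗ₘ κ

/-- The uniform distribution on `[0, 1]`. -/
def unif01 : Measure ℝ := volume.restrict (Set.Icc 0 1)

/-- The joint law of `S_m ∼ P^m` and, independently, `V ∼ Uniform([0, 1])^m`. -/
def sampleLaw {X Y : Type*} [MeasurableSpace X] [MeasurableSpace Y]
    (P : Measure (X × Y)) (m : ℕ) : Measure ((Fin m → X × Y) × (Fin m → ℝ)) :=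
  (Measure.pi fun _ => P).prod (Measure.pi fun _ => unif01)

end RSCP

end

/-
Call a trial `(z, v)` *accepted* if `v ≤ w z / b`, where `w = dQ/dP`. For a fixed event `B`, the
probability that a trial is accepted and lies in `B` is `Q B` times the probability that it is
accepted, so the number of accepted trials in `B` is binomial with parameter `Q B` given which
trials are accepted, and the binomial test for this parameter has level `δ`.

No union bound over the thresholds is needed: let `t` be an `ε`-quantile of `f` under `Q` and take
`B = {f ≤ t}`, so that `Q B ≥ ε`. If `L_Q(C_τ) > ε` for some `τ ≤ τ̂`, then `t < τ̂`, so every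
accepted trial in `B` is an error of `C_τ̂`; since `τ̂` is feasible, the binomial test for the
single event `B` then rejects, which has probability at most `δ`.
-/

namespace RSCP

open Finset Filter Topology

section BinomialTest

theorem binomCDF_eq_eval_sum_bernsteinPolynomial (k n : ℕ) (θ : ℝ) :
    binomCDF k n θ = (∑ i ∈ range (k + 1), bernsteinPolynomial ℝ n i).eval θ := by
  simp [binomCDF, bernsteinPolynomial, Polynomial.eval_finsetSum]

theorem derivative_sum_bernsteinPolynomial (R : Type*) [CommRing R] (k n : ℕ) :
    Polynomial.derivative (∑ i ∈ range (k + 1), bernsteinPolynomial R n i) =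
      -(n * bernsteinPolynomial R (n - 1) k) := by
  induction k with
  | zero => simp [bernsteinPolynomial.derivative_zero]
  | succ k ih =>
    rw [sum_range_succ, Polynomial.derivative_add, ih, bernsteinPolynomial.derivative_succ]
    ring

theorem continuous_binomCDF (k n : ℕ) : Continuous (binomCDF k n) := by
  unfold binomCDF
  fun_prop

theorem monotone_binomCDF_left (n : ℕ) {θ : ℝ} (hθ : θ ∈ Set.Icc (0 : ℝ) 1) :
    Monotone fun k => binomCDF k n θ := by
  have h0 : 0 ≤ θ := hθ.1
  have h1 : 0 ≤ 1 - θ := sub_nonneg.2 hθ.2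
  intro k l hkl
  exact sum_le_sum_of_subset_of_nonneg (range_mono (Nat.succ_le_succ hkl))
    fun i _ _ => by positivity

theorem antitoneOn_binomCDF (k n : ℕ) : AntitoneOn (binomCDF k n) (Set.Icc 0 1) := by
  refine antitoneOn_of_deriv_nonpos (convex_Icc 0 1) (continuous_binomCDF k n).continuousOn ?_ ?_
  all_goals rw [funext (binomCDF_eq_eval_sum_bernsteinPolynomial k n)]
  · exact Polynomial.differentiableOn _
  · intro θ hθ
    have h0 : 0 ≤ θ := (interior_subset hθ).1
    have h1 : 0 ≤ 1 - θ := sub_nonneg.2 (interior_subset hθ).2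
    rw [Polynomial.deriv, derivative_sum_bernsteinPolynomial, Polynomial.eval_neg, neg_nonpos]
    simp only [bernsteinPolynomial, Polynomial.eval_mul, Polynomial.eval_natCast,
      Polynomial.eval_pow, Polynomial.eval_X, Polynomial.eval_sub, Polynomial.eval_one]
    positivity

theorem binomCDF_self (n : ℕ) (θ : ℝ) : binomCDF n n θ = 1 := by
  rw [binomCDF_eq_eval_sum_bernsteinPolynomial, bernsteinPolynomial.sum, Polynomial.eval_one]

theorem bddBelow_cpUpper_set (k n : ℕ) (δ : ℝ) :
    BddBelow ({θ : ℝ | θ ∈ Set.Icc (0 : ℝ) 1 ∧ binomCDF k n θ ≤ δ} ∪ {1}) :=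
  ⟨0, by rintro θ (h | rfl); exacts [h.1.1, zero_le_one]⟩

theorem monotone_cpUpper_left (n : ℕ) (δ : ℝ) : Monotone fun k => cpUpper k n δ := by
  intro k l hkl
  refine csInf_le_csInf (bddBelow_cpUpper_set k n δ) ⟨1, Or.inr rfl⟩ ?_
  exact Set.union_subset_union_left _
    fun θ h => ⟨h.1, (monotone_binomCDF_left n h.1 hkl).trans h.2⟩

theorem cpUpper_self (n : ℕ) {δ : ℝ} (hδ : δ < 1) : cpUpper n n δ = 1 := by
  simp [cpUpper, binomCDF_self, hδ.not_ge]

theorem binomCDF_le_of_cpUpper_le {k n : ℕ} {δ θ : ℝ} (h : cpUpper k n δ ≤ θ)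
    (hlt : cpUpper k n δ < 1) (hθ : θ ≤ 1) : binomCDF k n θ ≤ δ := by
  have hclosed : IsClosed ({θ : ℝ | θ ∈ Set.Icc (0 : ℝ) 1 ∧ binomCDF k n θ ≤ δ} ∪ {1}) :=
    (isClosed_Icc.inter (isClosed_le (continuous_binomCDF k n) continuous_const)).union
      isClosed_singleton
  rcases hclosed.csInf_mem ⟨1, Or.inr rfl⟩ (bddBelow_cpUpper_set k n δ) with hmem | hone
  · exact (antitoneOn_binomCDF k n hmem.1 ⟨hmem.1.1.trans h, hθ⟩ h).trans hmem.2
  · exact absurd hone hlt.ne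

theorem sum_filter_partialSum_le {ι : Type*} [LinearOrder ι] (s : Finset ι) {g : ι → ℝ}
    (hg : ∀ i, 0 ≤ g i) {δ : ℝ} (hδ : 0 ≤ δ) :
    ∑ j ∈ s with ∑ i ∈ s with i ≤ j, g i ≤ δ, g j ≤ δ := by
  rcases (s.filter fun j => ∑ i ∈ s with i ≤ j, g i ≤ δ).eq_empty_or_nonempty with hempty | hne
  · rwa [hempty, sum_empty]
  · refine le_trans (sum_le_sum_of_subset_of_nonneg (fun j hj => ?_) fun j _ _ => hg j)
      (mem_filter.1 (max'_mem _ hne)).2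
    exact mem_filter.2 ⟨(mem_filter.1 hj).1, le_max' _ j hj⟩

theorem sum_powerset_binomCDF_le {ι : Type*} (I : Finset ι) {θ δ : ℝ}
    (hθ : θ ∈ Set.Icc (0 : ℝ) 1) (hδ : 0 ≤ δ) :
    ∑ J ∈ I.powerset with binomCDF #J #I θ ≤ δ, θ ^ #J * (1 - θ) ^ (#I - #J) ≤ δ := by
  have h0 : 0 ≤ θ := hθ.1
  have h1 : 0 ≤ 1 - θ := sub_nonneg.2 hθ.2
  let g (j : ℕ) : ℝ := (#I).choose j * θ ^ j * (1 - θ) ^ (#I - j)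
  have hcdf (j : ℕ) (hj : j ∈ range (#I + 1)) :
      ∑ i ∈ range (#I + 1) with i ≤ j, g i = binomCDF j #I θ := by
    refine sum_congr (Finset.ext fun i => ?_) fun _ _ => rfl
    simp only [mem_filter, mem_range] at hj ⊢
    lia
  calc ∑ J ∈ I.powerset with binomCDF #J #I θ ≤ δ, θ ^ #J * (1 - θ) ^ (#I - #J)
      = ∑ j ∈ range (#I + 1) with binomCDF j #I θ ≤ δ, g j := by
        rw [sum_filter, sum_filter, sum_powerset_apply_card
          fun j => if binomCDF j #I θ ≤ δ then θ ^ j * (1 - θ) ^ (#I - j) else 0]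
        exact sum_congr rfl fun j _ => by split_ifs <;> simp [g, mul_assoc]
    _ = ∑ j ∈ range (#I + 1) with ∑ i ∈ range (#I + 1) with i ≤ j, g i ≤ δ, g j := by
        exact sum_congr (filter_congr fun j hj => by rw [hcdf j hj]) fun _ _ => rfl
    _ ≤ δ := sum_filter_partialSum_le _ (fun j => by positivity) hδ

end BinomialTest

section Trials

variable {ι Ω : Type*} [Fintype ι]

open Classical in
/-- The set of indices of the trials in `ω` at which the event `A` occurs. -/
noncomputable def trialsIn (A : Set Ω) (ω : ι → Ω) : Finset ι :=
  univ.filter fun i => ω i ∈ A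

theorem mem_trialsIn {A : Set Ω} {ω : ι → Ω} {i : ι} : i ∈ trialsIn A ω ↔ ω i ∈ A := by
  simp [trialsIn]

theorem trialsIn_subset_trialsIn {A B : Set Ω} (h : A ⊆ B) (ω : ι → Ω) :
    trialsIn A ω ⊆ trialsIn B ω :=
  fun _ hi => mem_trialsIn.2 (h (mem_trialsIn.1 hi))

theorem prod_ite_mem_ite_mem {M : Type*} [CommMonoid M] [DecidableEq ι] {I J : Finset ι}
    (hJ : J ⊆ I) (a b c : M) :
    ∏ i, (if i ∈ J then a else if i ∈ I then b else c) =
      a ^ #J * b ^ (#I - #J) * c ^ (Fintype.card ι - #I) := by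
  have hmid : ({i | i ∉ J ∧ i ∈ I} : Finset ι) = I \ J := by grind
  have hout : ({i | i ∉ J ∧ i ∉ I} : Finset ι) = Iᶜ := by
    ext i
    grind [Finset.mem_compl]
  rw [prod_ite, prod_ite, filter_filter, filter_filter, hmid, hout, filter_univ_mem, prod_const,
    prod_const, prod_const, card_sdiff_of_subset hJ, card_compl, mul_assoc]

variable [MeasurableSpace Ω] (μ : Measure Ω)

theorem measureReal_pi_trialsIn_eq [SigmaFinite μ] {A E : Set Ω} (hEA : E ⊆ A) {I J : Finset ι}
    (hJ : J ⊆ I) :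
    (Measure.pi fun _ : ι => μ).real {ω | trialsIn A ω = I ∧ trialsIn E ω = J} =
      μ.real E ^ #J * μ.real (A \ E) ^ (#I - #J) * μ.real Aᶜ ^ (Fintype.card ι - #I) := by
  classical
  have hpi : {ω : ι → Ω | trialsIn A ω = I ∧ trialsIn E ω = J} =
      Set.univ.pi fun i => if i ∈ J then E else if i ∈ I then A \ E else Aᶜ := by
    ext ω
    simp only [Set.mem_ofPred_eq, Finset.ext_iff, mem_trialsIn, ← forall_and, Set.mem_univ_pi]
    refine forall_congr' fun i => ?_
    have hEAi := @hEA (ω i)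
    have hJi := @hJ i
    split_ifs <;> grind
  rw [hpi, measureReal_def, Measure.pi_pi, ENNReal.toReal_prod, ← prod_ite_mem_ite_mem hJ]
  simp only [measureReal_def, apply_ite μ, apply_ite ENNReal.toReal]

theorem measureReal_pi_trialsIn_eq_binomial [IsProbabilityMeasure μ] {A E : Set Ω}
    (hA : MeasurableSet A) (hE : MeasurableSet E) (hEA : E ⊆ A) {θ : ℝ}
    (h : μ.real E = μ.real A * θ) {I J : Finset ι} (hJ : J ⊆ I) :
    (Measure.pi fun _ : ι => μ).real {ω | trialsIn A ω = I ∧ trialsIn E ω = J} =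
      μ.real A ^ #I * (1 - μ.real A) ^ (Fintype.card ι - #I) *
        (θ ^ #J * (1 - θ) ^ (#I - #J)) := by
  have hdiff : μ.real (A \ E) = μ.real A * (1 - θ) := by
    rw [measureReal_sdiff hEA hE, h, mul_one_sub]
  rw [measureReal_pi_trialsIn_eq μ hEA hJ, h, hdiff, probReal_compl_eq_one_sub hA, mul_pow,
    mul_pow, ← pow_mul_pow_sub (μ.real A) (card_le_card hJ)]
  ring

theorem measureReal_pi_binomCDF_trialsIn_le [IsProbabilityMeasure μ] {A E : Set Ω}
    (hA : MeasurableSet A) (hE : MeasurableSet E) (hEA : E ⊆ A) {θ δ : ℝ}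
    (hθ : θ ∈ Set.Icc (0 : ℝ) 1) (hδ : 0 ≤ δ) (h : μ.real E = μ.real A * θ) :
    (Measure.pi fun _ : ι => μ).real
      {ω | binomCDF #(trialsIn E ω) #(trialsIn A ω) θ ≤ δ} ≤ δ := by
  set a := μ.real A
  have ha1 : 0 ≤ 1 - a := sub_nonneg.2 measureReal_le_one
  let rejecting (I : Finset ι) : Finset (Finset ι) := {J ∈ I.powerset | binomCDF #J #I θ ≤ δ}
  let cell (I J : Finset ι) : Set (ι → Ω) := {ω | trialsIn A ω = I ∧ trialsIn E ω = J}
  have hcover : {ω : ι → Ω | binomCDF #(trialsIn E ω) #(trialsIn A ω) θ ≤ δ} ⊆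
      ⋃ I ∈ (univ : Finset (Finset ι)), ⋃ J ∈ rejecting I, cell I J := by
    intro ω hω
    simp only [Set.mem_iUnion]
    exact ⟨trialsIn A ω, mem_univ _, trialsIn E ω,
      mem_filter.2 ⟨mem_powerset.2 (trialsIn_subset_trialsIn hEA ω), hω⟩, rfl, rfl⟩
  calc (Measure.pi fun _ : ι => μ).real {ω | binomCDF #(trialsIn E ω) #(trialsIn A ω) θ ≤ δ}
      ≤ ∑ I, ∑ J ∈ rejecting I, (Measure.pi fun _ : ι => μ).real (cell I J) :=
        (measureReal_mono hcover (measure_ne_top _ _)).trans <|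
          (measureReal_biUnion_finset_le _ _).trans <|
            sum_le_sum fun I _ => measureReal_biUnion_finset_le _ _
    _ = ∑ I : Finset ι, a ^ #I * (1 - a) ^ (Fintype.card ι - #I) *
          ∑ J ∈ rejecting I, θ ^ #J * (1 - θ) ^ (#I - #J) := by
        simp only [mul_sum]
        exact sum_congr rfl fun I _ => sum_congr rfl fun J hJ =>
          measureReal_pi_trialsIn_eq_binomial μ hA hE hEA h (mem_powerset.1 (mem_filter.1 hJ).1)
    _ ≤ ∑ I : Finset ι, a ^ #I * (1 - a) ^ (Fintype.card ι - #I) * δ :=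
        sum_le_sum fun I _ => mul_le_mul_of_nonneg_left
          (sum_powerset_binomCDF_le I hθ hδ) (by positivity)
    _ = δ := by
        rw [← sum_mul, Fintype.sum_pow_mul_eq_add_pow, add_sub_cancel, one_pow, one_mul]

end Trials

section RejectionSampling

instance : IsProbabilityMeasure unif01 := ⟨by simp [unif01]⟩

instance {X Y : Type*} [MeasurableSpace X] [MeasurableSpace Y] (P : Measure (X × Y))
    [IsProbabilityMeasure P] (m : ℕ) : IsProbabilityMeasure (sampleLaw P m) := by
  unfold sampleLaw
  infer_instance

theorem unif01_Iic {t : ℝ} (ht : t ≤ 1) : unif01 (Set.Iic t) = ENNReal.ofReal t := by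
  have hinter : Set.Iic t ∩ Set.Icc 0 1 = Set.Icc 0 t := by
    ext v
    grind
  rw [unif01, Measure.restrict_apply measurableSet_Iic, hinter, Real.volume_Icc, sub_zero]

variable {Z : Type*} {w : Z → ℝ≥0∞} {b : ℝ}

/-- The event that rejection sampling with weight `w` bounded by `b` accepts the point `u.1` when
the independent uniform variable takes the value `u.2`. -/
def acceptSet (w : Z → ℝ≥0∞) (b : ℝ) : Set (Z × ℝ) :=
  {u | u.2 ≤ (w u.1).toReal / b}

variable [MeasurableSpace Z]

theorem measurableSet_acceptSet (hw : Measurable w) (b : ℝ) : MeasurableSet (acceptSet w b) :=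
  measurableSet_le measurable_snd ((hw.comp measurable_fst).ennreal_toReal.div_const b)

theorem prod_unif01_acceptSet_inter (P : Measure Z) (hw : Measurable w) (hb0 : 0 < b)
    (hb : ∀ᵐ z ∂P, w z ≤ ENNReal.ofReal b) {B : Set Z} (hB : MeasurableSet B) :
    (P.prod unif01) (acceptSet w b ∩ Prod.fst ⁻¹' B) =
      ENNReal.ofReal b⁻¹ * P.withDensity w B := by
  have hslice : ∀ᵐ z ∂P, unif01 (Prod.mk z ⁻¹' (acceptSet w b ∩ Prod.fst ⁻¹' B)) =
      B.indicator (fun z => ENNReal.ofReal b⁻¹ * w z) z := by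
    filter_upwards [hb] with z hz
    by_cases hzB : z ∈ B
    · have hpre : Prod.mk z ⁻¹' (acceptSet w b ∩ Prod.fst ⁻¹' B) =
          Set.Iic ((w z).toReal / b) := by
        ext v
        simp [acceptSet, hzB]
      rw [hpre, unif01_Iic ((div_le_one hb0).2 (ENNReal.toReal_le_of_le_ofReal hb0.le hz)),
        Set.indicator_of_mem hzB, div_eq_inv_mul, ENNReal.ofReal_mul (inv_nonneg.2 hb0.le),
        ENNReal.ofReal_toReal (ne_top_of_le_ne_top ENNReal.ofReal_ne_top hz)]
    · simp [Set.preimage_inter, Set.preimage_preimage, hzB]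
  rw [Measure.prod_apply ((measurableSet_acceptSet hw b).inter (measurable_fst hB)),
    lintegral_congr_ae hslice, lintegral_indicator hB, lintegral_const_mul _ hw,
    withDensity_apply _ hB]

theorem pos_of_ae_le_ofReal_of_withDensity_ne_zero {P : Measure Z}
    (hb : ∀ᵐ z ∂P, w z ≤ ENNReal.ofReal b) (hne : P.withDensity w ≠ 0) : 0 < b := by
  by_contra! hb0
  have hw0 : w =ᵐ[P] 0 := by
    filter_upwards [hb] with z hz
    exact nonpos_iff_eq_zero.1 (hz.trans_eq (ENNReal.ofReal_of_nonpos hb0))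
  exact hne (by rw [withDensity_congr_ae hw0, withDensity_zero])

theorem measureReal_acceptSet_inter_eq_mul (P : Measure Z)
    [IsProbabilityMeasure (P.withDensity w)] (hw : Measurable w)
    (hb : ∀ᵐ z ∂P, w z ≤ ENNReal.ofReal b) {B : Set Z} (hB : MeasurableSet B) :
    (P.prod unif01).real (acceptSet w b ∩ Prod.fst ⁻¹' B) =
      (P.prod unif01).real (acceptSet w b) * (P.withDensity w).real B := by
  have hb0 : 0 < b :=
    pos_of_ae_le_ofReal_of_withDensity_ne_zero hb (IsProbabilityMeasure.ne_zero _)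
  have haccept := prod_unif01_acceptSet_inter P hw hb0 hb MeasurableSet.univ
  rw [Set.preimage_univ, Set.inter_univ, measure_univ, mul_one] at haccept
  simp only [measureReal_def, prod_unif01_acceptSet_inter P hw hb0 hb hB, haccept,
    ENNReal.toReal_mul]

theorem sampleLaw_binomCDF_trialsIn_le {X Y : Type*} [MeasurableSpace X] [MeasurableSpace Y]
    (P : Measure (X × Y)) [IsProbabilityMeasure P] {w : X × Y → ℝ≥0∞}
    [IsProbabilityMeasure (P.withDensity w)] (hw : Measurable w)
    (hb : ∀ᵐ z ∂P, w z ≤ ENNReal.ofReal b) {B : Set (X × Y)} (hB : MeasurableSet B) (m : ℕ)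
    {δ : ℝ} (hδ : 0 ≤ δ) :
    (sampleLaw P m).real {SV | binomCDF
      #(trialsIn (acceptSet w b ∩ Prod.fst ⁻¹' B) fun i => (SV.1 i, SV.2 i))
      #(trialsIn (acceptSet w b) fun i => (SV.1 i, SV.2 i)) ((P.withDensity w).real B) ≤ δ} ≤
      δ := by
  have hpair := measurePreserving_arrowProdEquivProdArrow (X × Y) ℝ (Fin m) (fun _ => P)
    (fun _ => unif01)
  have hA : MeasurableSet (acceptSet w b) := measurableSet_acceptSet hw b
  rw [sampleLaw, measureReal_def, ← hpair.measure_preimage_equiv]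
  exact measureReal_pi_binomCDF_trialsIn_le (P.prod unif01) hA (hA.inter (measurable_fst hB))
    Set.inter_subset_left ⟨measureReal_nonneg, measureReal_le_one⟩ hδ
    (measureReal_acceptSet_inter_eq_mul P hw hb hB)

end RejectionSampling

section Thresholds

variable {X Y : Type*} {m : ℕ} (f : X × Y → ℝ≥0) (S : Fin m → X × Y) (V w : Fin m → ℝ)
  (b : ℝ) {δ ε : ℝ}

open Classical in
theorem errCount_accepted (C : X → Set Y) :
    errCount C (accepted S V w b) =
      #{i | V i ≤ w i / b ∧ (S i).2 ∉ C (S i).1} := by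
  rw [errCount, accepted, Multiset.countP_map, ← filter_val, card_val, filter_filter]

theorem URSCP_mono {C D : X → Set Y} (h : ∀ i, (S i).2 ∉ C (S i).1 → (S i).2 ∉ D (S i).1)
    (δ : ℝ) : URSCP C S V w b δ ≤ URSCP D S V w b δ := by
  classical
  refine monotone_cpUpper_left _ δ ?_
  rw [errCount_accepted, errCount_accepted]
  exact card_le_card (monotone_filter_right _ fun i _ hi => ⟨hi.1, h i hi.2⟩)

theorem URSCP_eq_one {C : X → Set Y} (h : ∀ i, (S i).2 ∉ C (S i).1) (hδ : δ < 1) :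
    URSCP C S V w b δ = 1 := by
  classical
  have hcount : errCount C (accepted S V w b) = (accepted S V w b).card := by
    rw [errCount_accepted, accepted, Multiset.card_map, card_val]
    simp only [h, not_false_eq_true, and_true]
  rw [URSCP, UCP, hcount, cpUpper_self _ hδ]

theorem bddAbove_feasible (hδ : δ < 1) (hε : ε < 1) : BddAbove (feasible f S V w b δ ε) := by
  refine ⟨univ.sup fun i => f (S i), fun τ hτ => le_of_not_gt fun hlt => ?_⟩
  have hall (i : Fin m) : f (S i) < τ := (le_sup (f := f ∘ S) (mem_univ i)).trans_lt hlt
  have hone : URSCP (predSet f τ) S V w b δ = 1 :=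
    URSCP_eq_one S V w b (fun i => (hall i).not_ge) hδ
  exact hε.not_ge (hone.symm.trans_le hτ)

theorem isGreatest_tauHat (hδ : δ < 1) (hε : ε < 1) (hne : (feasible f S V w b δ ε).Nonempty) :
    IsGreatest (feasible f S V w b δ ε) (tauHat f S V w b δ ε) := by
  have hlub : IsLUB (feasible f S V w b δ ε) (tauHat f S V w b δ ε) :=
    isLUB_csSup hne (bddAbove_feasible f S V w b hδ hε)
  have herr : ∀ᶠ τ in 𝓝[≤] tauHat f S V w b δ ε,
      ∀ i, f (S i) < tauHat f S V w b δ ε → f (S i) < τ :=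
    eventually_all.2 fun i => eventually_imp_distrib_left.2 fun hi =>
      eventually_nhdsWithin_of_eventually_nhds (lt_mem_nhds hi)
  obtain ⟨τ, hτ, hlt⟩ := ((hlub.frequently_mem hne).and_eventually herr).exists
  refine ⟨(URSCP_mono S V w b (fun i hi => ?_) δ).trans hτ, hlub.1⟩
  exact (hlt i (lt_of_not_ge hi)).not_ge

theorem binomCDF_trialsIn_le_of_mem_feasible {w : X × Y → ℝ≥0∞} {τ : ℝ≥0}
    (hτ : τ ∈ feasible f S V (fun i => (w (S i)).toReal) b δ ε) (hε : ε < 1)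
    {B : Set (X × Y)} (hB : B ⊆ {z | f z < τ}) {θ : ℝ} (hθ : θ ∈ Set.Icc (0 : ℝ) 1) (hεθ : ε ≤ θ) :
    binomCDF #(trialsIn (acceptSet w b ∩ Prod.fst ⁻¹' B) fun i => (S i, V i))
      #(trialsIn (acceptSet w b) fun i => (S i, V i)) θ ≤ δ := by
  classical
  have hcdf := binomCDF_le_of_cpUpper_le (le_trans hτ hεθ) (lt_of_le_of_lt hτ hε) hθ.2
  rw [errCount_accepted, accepted, Multiset.card_map, card_val] at hcdf
  refine (monotone_binomCDF_left _ hθ (card_le_card fun i hi => ?_)).trans hcdf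
  obtain ⟨hacc, hiB⟩ := mem_trialsIn.1 hi
  have herr : ¬ τ ≤ f (S i) := (hB hiB).not_ge
  exact mem_filter.2 ⟨mem_univ i, hacc, herr⟩

end Thresholds

section Quantile

theorem exists_quantile (μ : Measure ℝ) [IsProbabilityMeasure μ] {p : ℝ}
    (hp : p ∈ Set.Ioo (0 : ℝ) 1) :
    ∃ t, μ.real (Set.Iio t) ≤ p ∧ p ≤ μ.real (Set.Iic t) := by
  set T : Set ℝ := {t | p ≤ cdf μ t}
  have hne : T.Nonempty := ((tendsto_cdf_atTop μ).eventually_const_le hp.2).exists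
  have hbdd : BddBelow T := by
    obtain ⟨s, hs⟩ := ((tendsto_cdf_atBot μ).eventually_lt_const hp.1).exists
    exact ⟨s, fun t ht => le_of_not_gt fun hts => (hs.trans_le ht).not_ge (monotone_cdf μ hts.le)⟩
  refine ⟨sInf T, ?_, ?_⟩
  · have hleft : Function.leftLim (cdf μ) (sInf T) ≤ p := by
      refine le_of_tendsto ((monotone_cdf μ).tendsto_leftLim (sInf T)) ?_
      filter_upwards [self_mem_nhdsWithin] with s hs
      exact (lt_of_not_ge fun hps => notMem_of_lt_csInf hs hbdd hps).le
    have hIio := (cdf μ).measure_Iio (tendsto_cdf_atBot μ) (sInf T)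
    rw [measure_cdf, sub_zero] at hIio
    rw [measureReal_def, hIio]
    exact ENNReal.toReal_le_of_le_ofReal hp.1.le (ENNReal.ofReal_le_ofReal hleft)
  · rw [← cdf_eq_real]
    refine ge_of_tendsto (((cdf μ).right_continuous (sInf T)).tendsto.mono_left
      (nhdsWithin_mono _ Set.Ioi_subset_Ici_self)) ?_
    filter_upwards [self_mem_nhdsWithin] with s hs
    obtain ⟨t, ht, hts⟩ := exists_lt_of_csInf_lt hne hs
    exact le_trans ht (monotone_cdf μ hts.le)

variable {X Y : Type*} [MeasurableSpace X] [MeasurableSpace Y] (Q : Measure (X × Y))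

theorem expErr_predSet (f : X × Y → ℝ≥0) (τ : ℝ≥0) :
    expErr Q (predSet f τ) = Q.real {z | f z < τ} := by
  simp [expErr, predSet]

theorem monotone_expErr_predSet [IsFiniteMeasure Q] (f : X × Y → ℝ≥0) :
    Monotone fun τ => expErr Q (predSet f τ) := by
  intro σ τ hστ
  simp only [expErr_predSet]
  exact measureReal_mono fun z hz => lt_of_lt_of_le hz hστ

theorem exists_le_measureReal_forall_subset_of_lt_expErr [IsProbabilityMeasure Q]
    {f : X × Y → ℝ≥0} (hf : Measurable f) {ε : ℝ} (hε : ε ∈ Set.Ioo (0 : ℝ) 1) :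
    ∃ B, MeasurableSet B ∧ ε ≤ Q.real B ∧
      ∀ τ, ε < expErr Q (predSet f τ) → B ⊆ {z | f z < τ} := by
  have hfR : Measurable fun z => (f z : ℝ) := measurable_coe_nnreal_real.comp hf
  have := Measure.isProbabilityMeasure_map (μ := Q) hfR.aemeasurable
  obtain ⟨t, ht_Iio, ht_Iic⟩ := exists_quantile (Q.map fun z => (f z : ℝ)) hε
  rw [map_measureReal_apply hfR measurableSet_Iio] at ht_Iio
  rw [map_measureReal_apply hfR measurableSet_Iic] at ht_Iic
  refine ⟨_, hfR measurableSet_Iic, ht_Iic, fun τ hτ => ?_⟩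
  have hlt : t < τ := by
    by_contra! hle
    rw [expErr_predSet] at hτ
    exact hτ.not_ge ((measureReal_mono fun z hz => (NNReal.coe_lt_coe.2 hz).trans_le hle).trans
      ht_Iio)
  exact fun z hz => NNReal.coe_lt_coe.1 (lt_of_le_of_lt hz hlt)

theorem feasible_nonempty_of_lt_expErr_tauHat {m : ℕ} {f : X × Y → ℝ≥0} {S : Fin m → X × Y}
    {V w : Fin m → ℝ} {b δ ε : ℝ} (hε : 0 ≤ ε)
    (h : ε < expErr Q (predSet f (tauHat f S V w b δ ε))) :
    (feasible f S V w b δ ε).Nonempty := by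
  by_contra hempty
  have hτ : tauHat f S V w b δ ε = 0 := by
    rw [tauHat, Set.not_nonempty_iff_eq_empty.1 hempty, csSup_empty, bot_eq_zero]
  simp only [hτ, expErr_predSet, not_lt_zero, Set.ofPred_false, measureReal_empty] at h
  exact h.not_ge hε

end Quantile

section CovariateShift

variable {X Y : Type*} [MeasurableSpace X] [MeasurableSpace Y]

theorem compProd_withDensity_left (μ : Measure X) [SFinite μ] (κ : Kernel X Y)
    [IsSFiniteKernel κ] {w : X → ℝ≥0∞} (hw : Measurable w) :
    μ.withDensity w ⊗ₘ κ = (μ ⊗ₘ κ).withDensity fun z => w z.1 := by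
  refine Measure.ext_of_lintegral _ fun g hg => ?_
  have hinner : Measurable fun x => ∫⁻ y, g (x, y) ∂κ x := hg.lintegral_kernel_prod_right'
  have hw' : Measurable fun z : X × Y => w z.1 := hw.comp measurable_fst
  calc ∫⁻ z, g z ∂(μ.withDensity w ⊗ₘ κ)
      = ∫⁻ x, w x * ∫⁻ y, g (x, y) ∂κ x ∂μ := by
        rw [Measure.lintegral_compProd hg, lintegral_withDensity_eq_lintegral_mul μ hw hinner]
        rfl
    _ = ∫⁻ x, ∫⁻ y, w x * g (x, y) ∂κ x ∂μ :=
        lintegral_congr fun x => (lintegral_const_mul _ (hg.comp measurable_prodMk_left)).symm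
    _ = ∫⁻ z, g z ∂((μ ⊗ₘ κ).withDensity fun z => w z.1) := by
        rw [lintegral_withDensity_eq_lintegral_mul _ hw' hg,
          Measure.lintegral_compProd (hw'.mul hg)]
        rfl

theorem CovariateShift.eq_withDensity {P Q : Measure (X × Y)} [SFinite P]
    (hshift : CovariateShift P Q) {w : X → ℝ≥0∞} (hw : Measurable w)
    (hQ : Q.fst = P.fst.withDensity w) : Q = P.withDensity fun z => w z.1 := by
  obtain ⟨κ, _, hPκ, hQκ⟩ := hshift
  rw [hQκ, hQ, compProd_withDensity_left _ _ hw, ← hPκ]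

theorem withDensity_impWeight (ν : Measure X) {pX qX : X → ℝ≥0∞} (hpX : AEMeasurable pX ν)
    (hqX : AEMeasurable qX ν) (hfin : ∀ᵐ x ∂ν, pX x ≠ ∞)
    (hw : ∀ᵐ x ∂ν, impWeight pX qX x ≠ ∞) :
    (ν.withDensity pX).withDensity (impWeight pX qX) = ν.withDensity qX := by
  have hmeas : AEMeasurable (impWeight pX qX) ν := hqX.div hpX
  rw [← withDensity_mul₀ hpX hmeas]
  refine withDensity_congr_ae ?_
  filter_upwards [hfin, hw] with x hpx hwx
  refine ENNReal.mul_div_cancel' (fun h0 => by_contra fun hq => hwx ?_) fun htop => absurd htop hpx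
  rw [impWeight, h0, ENNReal.div_zero hq]

theorem CovariateShift.eq_withDensity_impWeight {P Q : Measure (X × Y)} [IsFiniteMeasure P]
    (hshift : CovariateShift P Q) {ν : Measure X} {pX qX : X → ℝ≥0∞} (hpX : Measurable pX)
    (hqX : Measurable qX) (hP : P.fst = ν.withDensity pX) (hQ : Q.fst = ν.withDensity qX)
    (hw : ∀ᵐ x ∂ν, impWeight pX qX x ≠ ∞) : Q = P.withDensity fun z => impWeight pX qX z.1 := by
  have hfin : ∫⁻ x, pX x ∂ν ≠ ∞ := by
    rw [← setLIntegral_univ, ← withDensity_apply _ MeasurableSet.univ, ← hP]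
    exact measure_ne_top _ _
  refine hshift.eq_withDensity (hqX.div hpX) ?_
  rw [hP, hQ, withDensity_impWeight ν hpX.aemeasurable hqX.aemeasurable
    ((ae_lt_top hpX hfin).mono fun _ hx => hx.ne) hw]

end CovariateShift

theorem one_sub_measureReal_le_of_compl_subset {Ω : Type*} [MeasurableSpace Ω] {μ : Measure Ω}
    [IsProbabilityMeasure μ] {s t : Set Ω} (h : sᶜ ⊆ t) : 1 - μ.real t ≤ μ.real s := by
  rw [sub_le_iff_le_add, ← probReal_univ (μ := μ), ← Set.compl_subset_iff_union.1 h]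
  exact measureReal_union_le s t

end RSCP

open RSCP in
theorem theorem2_general {X Y : Type*} [MeasurableSpace X] [MeasurableSpace Y]
    (P Q : Measure (X × Y)) [IsProbabilityMeasure P] [IsProbabilityMeasure Q]
    (w : X × Y → ℝ≥0∞) (hw : Measurable w) (hQ : Q = P.withDensity w)
    (b : ℝ) (hb : ∀ᵐ z ∂P, w z ≤ ENNReal.ofReal b)
    (f : X × Y → ℝ≥0) (hf : Measurable f) (m : ℕ) (ε δ : ℝ)
    (hε : ε ∈ Set.Ioo (0 : ℝ) 1) (hδ : δ ∈ Set.Ioo (0 : ℝ) 1) :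
    (∀ (S : Fin m → X × Y) (V : Fin m → ℝ),
      (feasible f S V (fun i => (w (S i)).toReal) b δ ε).Nonempty →
        IsGreatest (feasible f S V (fun i => (w (S i)).toReal) b δ ε)
          (tauHat f S V (fun i => (w (S i)).toReal) b δ ε)) ∧
    1 - δ ≤ (sampleLaw P m).real
      {SV | ∀ τ : ℝ≥0, τ ≤ tauHat f SV.1 SV.2 (fun i => (w (SV.1 i)).toReal) b δ ε →
        expErr Q (predSet f τ) ≤ ε} := by
  refine ⟨fun S V hne => isGreatest_tauHat f S V _ b hδ.2 hε.2 hne, ?_⟩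
  obtain ⟨B, hB, hεB, hBsub⟩ := exists_le_measureReal_forall_subset_of_lt_expErr Q hf hε
  have hQB : Q.real B ∈ Set.Icc (0 : ℝ) 1 := ⟨measureReal_nonneg, measureReal_le_one⟩
  subst hQ
  have hlevel := sampleLaw_binomCDF_trialsIn_le P hw hb hB m hδ.1.le
  refine (sub_le_sub_left hlevel 1).trans (one_sub_measureReal_le_of_compl_subset ?_)
  rintro ⟨S, V⟩ hbad
  obtain ⟨τ, hτ, hετ⟩ : ∃ τ ≤ tauHat f S V (fun i => (w (S i)).toReal) b δ ε,
      ε < expErr (P.withDensity w) (predSet f τ) := by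
    simpa only [Set.mem_compl_iff, Set.mem_ofPred_eq, not_forall, not_le, exists_prop] using hbad
  have hετHat := hετ.trans_le (monotone_expErr_predSet _ f hτ)
  have hne := feasible_nonempty_of_lt_expErr_tauHat _ hε.1.le hετHat
  exact binomCDF_trialsIn_le_of_mem_feasible f S V b (isGreatest_tauHat f S V _ b hδ.2 hε.2 hne).1
    hε.2 (hBsub _ hετHat) hQB hεB

theorem theorem2 {X Y : Type*} [MeasurableSpace X] [MeasurableSpace Y]
    (P Q : Measure (X × Y)) [IsProbabilityMeasure P] [IsProbabilityMeasure Q]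
    (hshift : RSCP.CovariateShift P Q)
    (ν : Measure X) [SigmaFinite ν] (pX qX : X → ℝ≥0∞)
    (hpX : Measurable pX) (hqX : Measurable qX)
    (hP : P.fst = ν.withDensity pX) (hQ : Q.fst = ν.withDensity qX)
    (b : ℝ) (hb : ∀ x, RSCP.impWeight pX qX x ≤ ENNReal.ofReal b)
    (f : X × Y → ℝ≥0) (hf : Measurable f) (m : ℕ) (ε δ : ℝ)
    (hε : ε ∈ Set.Ioo (0 : ℝ) 1) (hδ : δ ∈ Set.Ioo (0 : ℝ) 1) :
    (∀ (S : Fin m → X × Y) (V : Fin m → ℝ),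
      (RSCP.feasible f S V (RSCP.weights pX qX S) b δ ε).Nonempty →
        IsGreatest (RSCP.feasible f S V (RSCP.weights pX qX S) b δ ε)
          (RSCP.tauHat f S V (RSCP.weights pX qX S) b δ ε)) ∧
    1 - δ ≤ (RSCP.sampleLaw P m).real
      {SV | ∀ τ : ℝ≥0, τ ≤ RSCP.tauHat f SV.1 SV.2 (RSCP.weights pX qX SV.1) b δ ε →
        RSCP.expErr Q (RSCP.predSet f τ) ≤ ε} := by
  exact theorem2_general P Q (fun z => RSCP.impWeight pX qX z.1) ((hqX.div hpX).comp measurable_fst)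
    (hshift.eq_withDensity_impWeight hpX hqX hP hQ
      (.of_forall fun x => ne_top_of_le_ne_top ENNReal.ofReal_ne_top (hb x)))
    b (.of_forall fun z => hb z.1) f hf m ε δ hε hδ
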